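/- **Setting.** Let $(\mathcal X,D)$ be a compact metric space of diameter at most $1$ and $\mu:\mathcal X\to\mathbb R$ a $1$-Lipschitz function; put $\mu^*=\max\mu$ and $\Delta(x)=\mu^*-\mu(x)$. For $r\in(0,1]$ let $N_z(r)$ be the least number of closed balls of radius at most $r/16$ covering $\{x:\Delta(x)\le r\}$. The zooming dimension $d_z$ is the smallest $q\ge 0$ for which there is $\alpha>0$ with $N_z(r)\le\alpha r^{-q}$ for all $r\in(0,1]$; fix such an $\alpha$ for $q=d_z$. In round $t=1,\dots,T$ (with $T\ge 2$) the agent pulls $x_t\in\mathcal X$ and observes $y_t=\mu(x_t)+\eta_t+c_t$. The noise $\eta_t$ is zero-mean $1$-sub-Gaussian conditionally on $(x_1,\dots,x_t,\eta_1,\dots,\eta_{t-1})$, and the corruption $c_t$ is chosen by a strong adversary, who also sees $x_t$ and the noisy reward; the corruptions satisfy $\sum_{t=1}^T|c_t|\le C$ almost surely, where $C\ge0$ is known to the agent. **Algorithm (Robust Zooming, with inputs $T$, $\delta\in(0,1)$, $C$).** For an active arm $x$ let $n(x)$ be the number of its pulls, $f(x)$ the average of its observed payoffs, and $$r(x)=\sqrt{\frac{4\ln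 T+2\ln(2/\delta)}{n(x)}}+\frac{C}{n(x)} .$$ Start with the active set $J=\emptyset$ and the active region $\mathcal X_{act}=\mathcal X$. In each round: (1) if $f(v)-f(u)\ge r(v)+2r(u)$ for some $u,v\in J$, take one such pair and remove $u$ from $J$ and the closed ball $\mathcal B(u,r(u))$ from $\mathcal X_{act}$; (2) if $\mathcal X_{act}\not\subseteq\bigcup_{v\in J}\mathcal B(v,r(v))$, activate (add to $J$, with $n=f=0$) and pull some arm of $\mathcal X_{act}\setminus\bigcup_{v\in J}\mathcal B(v,r(v))$; otherwise pull an arm of $J$ maximizing $f(v)+2r(v)$; (3) observe the payoff and update $n$ and $f$ of the pulled arm. All choices and ties are resolved arbitrarily. **Theorem.** There is a constant $K$ depending only on $d_z$, $\alpha$ and $\delta$ such that, for every such instance, every $T\ge2$, $C\ge0$, every strong adversary with budget at most $C$ and every way of making the arbitrary choices, with probability at least $1-\delta$ $$T\mu^*-\sum_{t=1}^T\mu(x_t)\ \le\ K\left((\ln T)^{\frac1{d_z+2}}\,T^{\frac{d_z+1}{d_z+2}}+\lambda\, C^{\frac1{d_z+1}}\,T^{\frac{d_z}{d_z+1}}\right),$$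 where $\lambda=1$ if $d_z>0$ and $\lambda=\ln T$ if $d_z=0$. -/

import Mathlib

open MeasureTheory
open scoped NNReal ENNReal

namespace RobustZooming

noncomputable section

/-! ### The Lipschitz bandit instance -/

/-- The loss `Δ(x) = μ(x_*) - μ(x)` of an arm. -/
def gap {X : Type*} (μ : X → ℝ) (x : X) : ℝ := (⨆ z, μ z) - μ x

/-- The cumulative regret `T μ(x_*) - ∑ μ(x_t)` of the arms pulled in rounds `0, …, T - 1`. -/
def regret {X : Type*} (μ : X → ℝ) (x : ℕ → X) (T : ℕ) : ℝ :=
  T * (⨆ z, μ z) - ∑ t ∈ Finset.range T, μ (x t)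

/-- The `r`-zooming number: the least number of closed balls of radius `r / 16` (with centres
anywhere in `X`) that cover the `r`-optimal region `{x | Δ(x) ≤ r}`. -/
def zoomingNumber {X : Type*} [MetricSpace X] (μ : X → ℝ) (r : ℝ) : ℕ∞ :=
  Metric.externalCoveringNumber (Real.toNNReal (r / 16)) {x : X | gap μ x ≤ r}

/-- `N_z(r) ≤ α r ^ (-q)` for every `r ∈ (0, 1]`. -/
def ZoomingBound {X : Type*} [MetricSpace X] (μ : X → ℝ) (α q : ℝ) : Prop :=
  ∀ r : ℝ, 0 < r → r ≤ 1 →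
    ((zoomingNumber μ r : ℕ∞) : ℝ≥0∞) ≤ ENNReal.ofReal (α * r ^ (-q))

/-- `d` is the zooming dimension: the smallest `q ≥ 0` such that `N_z(r) ≤ α r ^ (-q)` on `(0, 1]`
for some multiplier `α > 0`. -/
def IsZoomingDimension {X : Type*} [MetricSpace X] (μ : X → ℝ) (d : ℝ) : Prop :=
  IsLeast {q : ℝ | 0 ≤ q ∧ ∃ α : ℝ, 0 < α ∧ ZoomingBound μ α q} d

/-! ### The Robust Zooming algorithm -/

/-- The confidence radius of an arm that has been pulled `n` times. -/
def radius (T : ℕ) (δ C : ℝ) (n : ℕ) : ℝ :=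
  Real.sqrt ((4 * Real.log T + 2 * Real.log (2 / δ)) / n) + C / n

/-- The memory of the algorithm: the active arms `J`, the active region `X_act`, and for each arm
the number of pulls `n` and the average observed payoff `f`. -/
structure State (X : Type*) where
  active : Set X
  region : Set X
  count : X → ℕ
  avg : X → ℝ

/-- At the start no arm is active and the active region is the whole space. -/
def State.init (X : Type*) : State X where
  active := ∅
  region := Set.univ
  count := fun _ => 0
  avg := fun _ => 0

/-- The current confidence radius `r(v)`. -/
def State.rad {X : Type*} (S : State X) (T : ℕ) (δ C : ℝ) (v : X) : ℝ :=
  radius T δ C (S.count v)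

/-- The union of the confidence balls of the active arms. -/
def State.covered {X : Type*} [MetricSpace X] (S : State X) (T : ℕ) (δ C : ℝ) : Set X :=
  ⋃ v ∈ S.active, Metric.closedBall v (S.rad T δ C v)

/-- The removal condition `f(v) - f(u) ≥ r(v) + 2 r(u)` for a pair of active arms `u`, `v`. -/
def State.Dominated {X : Type*} (S : State X) (T : ℕ) (δ C : ℝ) (u v : X) : Prop :=
  u ∈ S.active ∧ v ∈ S.active ∧
    S.rad T δ C v + 2 * S.rad T δ C u ≤ S.avg v - S.avg u

/-- Removal of an arm `u` together with its confidence ball. -/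
def State.remove {X : Type*} [MetricSpace X] (S : State X) (T : ℕ) (δ C : ℝ) (u : X) : State X :=
  { S with
    active := S.active \ {u}
    region := S.region \ Metric.closedBall u (S.rad T δ C u) }

/-- The removal step: if some pair of active arms satisfies the removal condition, then the
dominated arm of one such pair (no matter which) is removed; otherwise nothing happens. -/
def RemovalStep {X : Type*} [MetricSpace X] (T : ℕ) (δ C : ℝ) (S S' : State X) : Prop :=
  (∃ u v, S.Dominated T δ C u v ∧ S' = S.remove T δ C u) ∨
    ((¬ ∃ u v, S.Dominated T δ C u v) ∧ S' = S)

open Classical in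
/-- Activation of the arm `x`. -/
def State.activate {X : Type*} (S : State X) (x : X) : State X :=
  { S with
    active := insert x S.active
    count := Function.update S.count x 0
    avg := Function.update S.avg x 0 }

/-- The choice of the arm `x`. If the active region is not covered by the confidence balls of the
active arms, `x` is any uncovered arm of the active region, and it is activated. Otherwise `x` is
an active arm that maximizes the index `f(v) + 2 r(v)`, ties being broken arbitrarily. -/
def ChoiceStep {X : Type*} [MetricSpace X] (T : ℕ) (δ C : ℝ) (S : State X) (x : X)
    (S' : State X) : Prop :=
  (¬ S.region ⊆ S.covered T δ C ∧ x ∈ S.region ∧ x ∉ S.covered T δ C ∧ S' = S.activate x) ∨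
    (S.region ⊆ S.covered T δ C ∧ x ∈ S.active ∧
      (∀ v ∈ S.active, S.avg v + 2 * S.rad T δ C v ≤ S.avg x + 2 * S.rad T δ C x) ∧ S' = S)

open Classical in
/-- The update of `n(x)` and `f(x)` after the payoff `y` of the pulled arm `x` is observed. -/
def State.observe {X : Type*} (S : State X) (x : X) (y : ℝ) : State X :=
  { S with
    count := Function.update S.count x (S.count x + 1)
    avg := Function.update S.avg x ((S.avg x * S.count x + y) / (S.count x + 1)) }

/-- One round: removal, then choice of the arm `x`, then observation of the payoff `y`. -/
def Round {X : Type*} [MetricSpace X] (T : ℕ) (δ C : ℝ) (S : State X) (x : X) (y : ℝ)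
    (S' : State X) : Prop :=
  ∃ S₁ S₂ : State X, RemovalStep T δ C S S₁ ∧ ChoiceStep T δ C S₁ x S₂ ∧ S' = S₂.observe x y

/-- `x` is a sequence of arms that the Robust Zooming algorithm with horizon `T`, probability
rate `δ` and budget `C` may pull when the observed payoffs are `y`. -/
def IsRun {X : Type*} [MetricSpace X] (T : ℕ) (δ C : ℝ) (x : ℕ → X) (y : ℕ → ℝ) : Prop :=
  ∃ S : ℕ → State X, S 0 = State.init X ∧ ∀ t < T, Round T δ C (S t) (x t) (y t) (S (t + 1))

/-! ### The noise -/

/-- The σ-algebra generated by the arms `x_s`, `s ≤ t`, and the noise `η_s`, `s < t`. -/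
abbrev history {Ω X : Type*} [MeasurableSpace X] (x : ℕ → Ω → X) (η : ℕ → Ω → ℝ) (t : ℕ) :
    MeasurableSpace Ω :=
  (⨆ s ∈ Set.Iic t, MeasurableSpace.comap (x s) inferInstance) ⊔
    ⨆ s ∈ Set.Iio t, MeasurableSpace.comap (η s) inferInstance

/-- `Y` is zero-mean sub-Gaussian with parameter `σ` conditionally on `m`:
`E[exp (l Y) | m] ≤ exp (σ² l² / 2)` almost surely, for every real `l`. (The bound for all `l`
of both signs forces `E[Y | m] = 0`.) -/
def CondSubgaussian {Ω : Type*} [MeasurableSpace Ω] (P : Measure Ω) (m : MeasurableSpace Ω)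
    (Y : Ω → ℝ) (σ : ℝ) : Prop :=
  ∀ l : ℝ, Integrable (fun ω => Real.exp (l * Y ω)) P ∧
    ∀ᵐ ω ∂P, (P[fun ω' => Real.exp (l * Y ω') | m]) ω ≤ Real.exp (σ ^ 2 * l ^ 2 / 2)

end

end RobustZooming

/-!
The proof works on a single likely event and is deterministic there.

*Concentration.* Noise summed over predictably selected rounds is the logarithm of a
supermartingale up to a compensator (`lintegral_expProcess_le_one`), so Chernoff's bound controls
the sum over the first `n` pulls of an arm (`measure_selected_noise_le`). Arms are random and `X`
may be uncountable, but a pulled arm is determined by the round of its first pull; there are `T`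
such rounds and `T` values of `n`, and each failure has probability at most `δ / T ^ 2`
(`measure_noisyEvents_le`). Off these events, since corruptions of total size `C` move an average
of `n` payoffs by at most `C / n`, every average is within its confidence radius of the mean, at
every time (`accurate_of_noise`).

*The run.* With accurate averages the algorithm maintains `Invariant`. A removed ball contains an
optimal arm only if the dominating arm is itself optimal, so an optimal arm always survives in the
active region or among the active arms. The index of the arm covering it is then at least the
optimal mean, whence a pulled arm has a gap of at most three radii before the pull and six after
it. A newly activated arm lies outside all balls of active arms and all removed balls, so distinct
pulled arms are separated by the smaller of their radii, hence by a sixth of the smaller gap.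

*Summation.* An arm with gap `g` costs at most the order of `log T / g + C`, by inverting the
radius. Arms with gaps in `(3 r / 4, r]` are more than `r / 8` apart, so there are at most
`α * r ^ (-d)` of them (`card_le_of_zoomingBound`). Summing over the scales `r = (3 / 4) ^ i` above
a threshold `R`, and bounding the remaining rounds by `T * R`, gives a total of the order of
`T * R + log T * R ^ (-(d + 1)) + C * R ^ (-d)`; for `d = 0` the last sum has logarithmically many
equal terms instead. The larger of the two values of `R` that balance `T * R` against the noise
term and against the corruption term gives the two rates (`threshold_sum_le`).
-/

namespace RobustZooming

/-! ### Concentration of adaptively selected noise -/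

section Concentration

variable {Ω : Type*} {m mΩ : MeasurableSpace Ω} {P : Measure Ω} [IsProbabilityMeasure P]

/-- The conditional moment bound, tested against an arbitrary nonnegative function that is
measurable for the conditioning σ-algebra. Working with lower integrals avoids any integrability
condition on the weight `g`. -/
lemma CondSubgaussian.lintegral_mul_exp_le (hm : m ≤ mΩ) {Y : Ω → ℝ}
    {σ : ℝ} (hY : CondSubgaussian P m Y σ) (l : ℝ) {g : Ω → ℝ≥0∞} (hg : Measurable[m] g) :
    ∫⁻ ω, g ω * ENNReal.ofReal (Real.exp (l * Y ω)) ∂P ≤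
      ENNReal.ofReal (Real.exp (σ ^ 2 * l ^ 2 / 2)) * ∫⁻ ω, g ω ∂P := by
  obtain ⟨hint, hbound⟩ := hY l
  set e : Ω → ℝ≥0∞ := fun ω => ENNReal.ofReal (Real.exp (l * Y ω)) with he
  set K : ℝ≥0∞ := ENNReal.ofReal (Real.exp (σ ^ 2 * l ^ 2 / 2)) with hK
  have hem : AEMeasurable e P := hint.aestronglyMeasurable.aemeasurable.ennreal_ofReal
  have key : (P.withDensity e).trim hm ≤ K • P.trim hm := by
    refine Measure.le_iff.2 fun s hs => ?_
    rw [trim_measurableSet_eq hm hs, Measure.smul_apply, trim_measurableSet_eq hm hs,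
      withDensity_apply _ (hm s hs), smul_eq_mul, he,
      ← ofReal_integral_eq_lintegral_ofReal hint.integrableOn
        (Filter.Eventually.of_forall fun _ => (Real.exp_pos _).le),
      ← setIntegral_condExp hm hint hs]
    have h1 : ∫ ω in s, (P[fun ω' => Real.exp (l * Y ω') | m]) ω ∂P ≤
        ∫ _ in s, Real.exp (σ ^ 2 * l ^ 2 / 2) ∂P :=
      integral_mono_ae integrable_condExp.integrableOn (integrable_const _).integrableOn
        (ae_restrict_of_ae hbound)
    refine (ENNReal.ofReal_le_ofReal h1).trans ?_
    rw [setIntegral_const, smul_eq_mul, ENNReal.ofReal_mul measureReal_nonneg, mul_comm,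
      ofReal_measureReal]
  calc ∫⁻ ω, g ω * e ω ∂P = ∫⁻ ω, g ω ∂(P.withDensity e) := by
        rw [lintegral_withDensity_eq_lintegral_mul₀ hem (hg.mono hm le_rfl).aemeasurable]
        simp [mul_comm]
    _ = ∫⁻ ω, g ω ∂((P.withDensity e).trim hm) := (lintegral_trim hm hg).symm
    _ ≤ ∫⁻ ω, g ω ∂(K • P.trim hm) := lintegral_mono' key le_rfl
    _ = K * ∫⁻ ω, g ω ∂P := by rw [lintegral_smul_measure, lintegral_trim hm hg, smul_eq_mul]

/-- The exponential supermartingale of the noise summed over the rounds `u < k` in which the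
predictable event `A u` occurs. -/
noncomputable def expProcess (η : ℕ → Ω → ℝ) (A : ℕ → Set Ω) (l : ℝ) (k : ℕ) (ω : Ω) : ℝ :=
  Real.exp (∑ u ∈ Finset.range k, (A u).indicator (fun ω => l * η u ω - l ^ 2 / 2) ω)

lemma measurable_expProcess {η : ℕ → Ω → ℝ} {A : ℕ → Set Ω} {k : ℕ}
    (hη : ∀ u < k, Measurable[m] (η u)) (hA : ∀ u < k, MeasurableSet[m] (A u)) (l : ℝ) :
    Measurable[m] (expProcess η A l k) := by
  refine Real.measurable_exp.comp (Finset.measurable_fun_sum _ fun u hu => ?_)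
  have hu := Finset.mem_range.1 hu
  exact (((hη u hu).const_mul l).sub_const _).indicator (hA u hu)

lemma lintegral_expProcess_le_one {T : ℕ} {η : ℕ → Ω → ℝ} {A : ℕ → Set Ω}
    {H : ℕ → MeasurableSpace Ω} (hH : ∀ t < T, H t ≤ mΩ)
    (hη : ∀ t < T, ∀ u < t, Measurable[H t] (η u))
    (hA : ∀ t < T, ∀ u ≤ t, MeasurableSet[H t] (A u))
    (hsub : ∀ t < T, CondSubgaussian P (H t) (η t) 1) (l : ℝ) {k : ℕ} (hk : k ≤ T) :
    ∫⁻ ω, ENNReal.ofReal (expProcess η A l k ω) ∂P ≤ 1 := by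
  induction k with
  | zero => simp [expProcess]
  | succ k ih =>
    have hkT : k < T := hk
    specialize ih hkT.le
    set W : Ω → ℝ≥0∞ := fun ω => ENNReal.ofReal (expProcess η A l k ω) with hW
    have hWm : Measurable[H k] W :=
      (measurable_expProcess (hη k hkT) (fun u hu => hA k hkT u hu.le) l).ennreal_ofReal
    have hAk : MeasurableSet[H k] (A k) := hA k hkT k le_rfl
    set g : Ω → ℝ≥0∞ := (A k).indicator W with hg
    have hgm : Measurable[H k] g := hWm.indicator hAk
    set κ : ℝ≥0∞ := ENNReal.ofReal (Real.exp (-(l ^ 2 / 2))) with hκ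
    have hstep : ∀ ω, ENNReal.ofReal (expProcess η A l (k + 1) ω) =
        (A k)ᶜ.indicator W ω + κ * (g ω * ENNReal.ofReal (Real.exp (l * η k ω))) := by
      intro ω
      simp only [hg, hW, hκ, expProcess, Finset.sum_range_succ]
      by_cases h : ω ∈ A k
      · simp only [h, Set.indicator_of_mem, Set.mem_compl_iff, not_true_eq_false,
          not_false_eq_true, Set.indicator_of_notMem, zero_add]
        rw [← ENNReal.ofReal_mul (Real.exp_pos _).le, ← Real.exp_add,
          ← ENNReal.ofReal_mul (Real.exp_pos _).le, ← Real.exp_add]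
        congr 2
        ring
      · simp [h]
    calc ∫⁻ ω, ENNReal.ofReal (expProcess η A l (k + 1) ω) ∂P
        = ∫⁻ ω, (A k)ᶜ.indicator W ω ∂P +
          κ * ∫⁻ ω, g ω * ENNReal.ofReal (Real.exp (l * η k ω)) ∂P := by
          simp_rw [hstep]
          rw [lintegral_add_left ((hWm.indicator hAk.compl).mono (hH k hkT) le_rfl),
            lintegral_const_mul' _ _ (by simp [hκ])]
      _ ≤ ∫⁻ ω, (A k)ᶜ.indicator W ω ∂P +
          κ * (ENNReal.ofReal (Real.exp (1 ^ 2 * l ^ 2 / 2)) * ∫⁻ ω, g ω ∂P) := by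
          gcongr
          exact (hsub k hkT).lintegral_mul_exp_le (hH k hkT) l hgm
      _ = ∫⁻ ω, (A k)ᶜ.indicator W ω ∂P + ∫⁻ ω, g ω ∂P := by
          rw [← mul_assoc, hκ, ← ENNReal.ofReal_mul (Real.exp_pos _).le, ← Real.exp_add]
          simp
      _ = ∫⁻ ω, W ω ∂P := by
          rw [← lintegral_add_left ((hWm.indicator hAk.compl).mono (hH k hkT) le_rfl)]
          congr 1 with ω
          exact Set.indicator_compl_add_self_apply (A k) W ω
      _ ≤ 1 := ih

/-- Hoeffding's inequality for the noise summed over predictably selected rounds, on the event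
that exactly `n` rounds are selected. -/
lemma measure_selected_noise_le {T : ℕ} {η : ℕ → Ω → ℝ} {A : ℕ → Set Ω}
    {H : ℕ → MeasurableSpace Ω} (hH : ∀ t < T, H t ≤ mΩ)
    (hηm : ∀ t < T, Measurable (η t))
    (hη : ∀ t < T, ∀ u < t, Measurable[H t] (η u))
    (hA : ∀ t < T, ∀ u ≤ t, MeasurableSet[H t] (A u))
    (hsub : ∀ t < T, CondSubgaussian P (H t) (η t) 1) {n : ℕ} (hn : 0 < n) {a : ℝ} (ha : 0 ≤ a) :
    P {ω | ∑ u ∈ Finset.range T, (A u).indicator (fun _ => (1 : ℝ)) ω = n ∧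
        Real.sqrt (a * n) < |∑ u ∈ Finset.range T, (A u).indicator (η u) ω|} ≤
      ENNReal.ofReal (2 * Real.exp (-(a / 2))) := by
  have hn' : (0 : ℝ) < n := by exact_mod_cast hn
  have tail : ∀ l : ℝ, P {ω | a / 2 ≤
      ∑ u ∈ Finset.range T, (A u).indicator (fun ω => l * η u ω - l ^ 2 / 2) ω} ≤
      ENNReal.ofReal (Real.exp (-(a / 2))) := by
    intro l
    have hm : Measurable (expProcess η A l T) :=
      measurable_expProcess hηm (fun u hu => hH u hu _ (hA u hu u le_rfl)) l
    have h1 := mul_meas_ge_le_lintegral₀ (μ := P) hm.ennreal_ofReal.aemeasurable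
      (ENNReal.ofReal (Real.exp (a / 2)))
    have h2 := h1.trans (lintegral_expProcess_le_one hH hη hA hsub l le_rfl)
    have h3 : P {ω | ENNReal.ofReal (Real.exp (a / 2)) ≤
        ENNReal.ofReal (expProcess η A l T ω)} ≤ ENNReal.ofReal (Real.exp (-(a / 2))) := by
      rw [Real.exp_neg, ENNReal.ofReal_inv_of_pos (Real.exp_pos _)]
      exact ENNReal.le_inv_iff_mul_le.2 (by rwa [mul_comm])
    refine (measure_mono fun ω hω => ?_).trans h3
    exact ENNReal.ofReal_le_ofReal (Real.exp_le_exp.2 hω)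
  have hsplit : ∀ l ω, ∑ u ∈ Finset.range T, (A u).indicator (fun ω => l * η u ω - l ^ 2 / 2) ω =
      l * (∑ u ∈ Finset.range T, (A u).indicator (η u) ω) -
        l ^ 2 / 2 * ∑ u ∈ Finset.range T, (A u).indicator (fun _ => (1 : ℝ)) ω := by
    intro l ω
    rw [Finset.mul_sum, Finset.mul_sum, ← Finset.sum_sub_distrib]
    refine Finset.sum_congr rfl fun u _ => ?_
    by_cases h : ω ∈ A u <;> simp [h]
  -- the optimal exponent in Chernoff's bound
  set l : ℝ := Real.sqrt (a / n) with hl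
  have hl2 : l ^ 2 * n = a := by
    rw [hl, Real.sq_sqrt (by positivity)]
    field_simp
  have hls : Real.sqrt (a * n) = l * n := by
    rw [← hl2, show l ^ 2 * n * n = (l * n) ^ 2 by ring, Real.sqrt_sq (by positivity)]
  calc _ ≤ P ({ω | a / 2 ≤ ∑ u ∈ Finset.range T,
            (A u).indicator (fun ω => l * η u ω - l ^ 2 / 2) ω} ∪
          {ω | a / 2 ≤ ∑ u ∈ Finset.range T,
            (A u).indicator (fun ω => -l * η u ω - (-l) ^ 2 / 2) ω}) := by
        refine measure_mono fun ω hω => ?_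
        obtain ⟨h1, h2⟩ := hω
        have hl0 : 0 ≤ l := Real.sqrt_nonneg _
        rw [Set.mem_union, Set.mem_ofPred_eq, Set.mem_ofPred_eq, hsplit, hsplit, h1]
        rw [hls] at h2
        rcases lt_abs.1 h2 with h | h
        · left
          nlinarith [mul_le_mul_of_nonneg_left h.le hl0]
        · right
          nlinarith [mul_le_mul_of_nonneg_left h.le hl0]
    _ ≤ _ := measure_union_le _ _
    _ ≤ _ := add_le_add (tail l) (tail (-l))
    _ = _ := by
        rw [← ENNReal.ofReal_add (Real.exp_pos _).le (Real.exp_pos _).le, two_mul]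

end Concentration

/-! ### Analysis of a run on the event of accurate averages -/

section Run

variable {X : Type*}

open Classical in
/-- The number of rounds before round `t` in which the arm `v` is pulled. -/
noncomputable def pulls (x : ℕ → X) (v : X) (t : ℕ) : ℕ :=
  ((Finset.range t).filter fun u => x u = v).card

open Classical in
/-- The sum of a sequence `y` over the rounds before round `t` in which the arm `v` is pulled. -/
noncomputable def pullSum (x : ℕ → X) (y : ℕ → ℝ) (v : X) (t : ℕ) : ℝ :=
  ∑ u ∈ (Finset.range t).filter fun u => x u = v, y u

lemma pulls_succ_self {x : ℕ → X} {v : X} {t : ℕ} (h : x t = v) :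
    pulls x v (t + 1) = pulls x v t + 1 := by
  simp [pulls, Finset.range_add_one, Finset.filter_insert, h]

lemma pulls_succ_of_ne {x : ℕ → X} {v : X} {t : ℕ} (h : x t ≠ v) :
    pulls x v (t + 1) = pulls x v t := by
  simp [pulls, Finset.range_add_one, Finset.filter_insert, h]

lemma pulls_mono (x : ℕ → X) (v : X) : Monotone (pulls x v) := by
  classical
  exact fun _ _ h => Finset.card_le_card (Finset.filter_subset_filter _ (Finset.range_mono h))

lemma pullSum_succ_self {x : ℕ → X} {y : ℕ → ℝ} {v : X} {t : ℕ} (h : x t = v) :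
    pullSum x y v (t + 1) = pullSum x y v t + y t := by
  simp [pullSum, Finset.range_add_one, Finset.filter_insert, h, add_comm]

lemma pullSum_succ_of_ne {x : ℕ → X} {y : ℕ → ℝ} {v : X} {t : ℕ} (h : x t ≠ v) :
    pullSum x y v (t + 1) = pullSum x y v t := by
  simp [pullSum, Finset.range_add_one, Finset.filter_insert, h]

lemma pullSum_eq_zero {x : ℕ → X} {y : ℕ → ℝ} {v : X} {t : ℕ} (h : pulls x v t = 0) :
    pullSum x y v t = 0 := by
  rw [pullSum, Finset.card_eq_zero.1 h, Finset.sum_empty]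

section Radius

variable {T : ℕ} {δ C : ℝ}

lemma two_le_logTerm (hT : 2 ≤ T) (hδ0 : 0 < δ) (hδ1 : δ < 1) :
    2 ≤ 4 * Real.log T + 2 * Real.log (2 / δ) := by
  have h1 : Real.log 2 ≤ Real.log T := Real.log_le_log (by norm_num) (by exact_mod_cast hT)
  have h2 : 0 ≤ Real.log (2 / δ) := Real.log_nonneg (by rw [le_div_iff₀ hδ0]; linarith)
  linarith [Real.log_two_gt_d9]

lemma radius_pos (hT : 2 ≤ T) (hδ0 : 0 < δ) (hδ1 : δ < 1) (hC : 0 ≤ C) {n : ℕ} (hn : 0 < n) :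
    0 < radius T δ C n := by
  have := two_le_logTerm hT hδ0 hδ1
  have hn' : (0 : ℝ) < n := by exact_mod_cast hn
  have h1 : 0 < Real.sqrt ((4 * Real.log T + 2 * Real.log (2 / δ)) / n) :=
    Real.sqrt_pos.2 (by positivity)
  unfold radius
  positivity

lemma one_le_radius_one (hT : 2 ≤ T) (hδ0 : 0 < δ) (hδ1 : δ < 1) (hC : 0 ≤ C) :
    1 ≤ radius T δ C 1 := by
  have := two_le_logTerm hT hδ0 hδ1
  have h1 : 1 ≤ Real.sqrt ((4 * Real.log T + 2 * Real.log (2 / δ)) / (1 : ℕ)) := by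
    rw [Real.one_le_sqrt]; norm_num; linarith
  unfold radius
  have : 0 ≤ C / (1 : ℕ) := by positivity
  linarith

lemma radius_anti (hT : 2 ≤ T) (hδ0 : 0 < δ) (hδ1 : δ < 1) (hC : 0 ≤ C) {m n : ℕ} (hm : 0 < m)
    (hmn : m ≤ n) : radius T δ C n ≤ radius T δ C m := by
  have := two_le_logTerm hT hδ0 hδ1
  have hm' : (0 : ℝ) < m := by exact_mod_cast hm
  have hmn' : (m : ℝ) ≤ n := by exact_mod_cast hmn
  unfold radius
  gcongr

lemma radius_le_two_mul_succ (hT : 2 ≤ T) (hδ0 : 0 < δ) (hδ1 : δ < 1) (hC : 0 ≤ C) {n : ℕ}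
    (hn : 0 < n) : radius T δ C n ≤ 2 * radius T δ C (n + 1) := by
  have hA := two_le_logTerm hT hδ0 hδ1
  unfold radius
  set A := 4 * Real.log T + 2 * Real.log (2 / δ)
  have hn' : (1 : ℝ) ≤ n := by exact_mod_cast hn
  push_cast
  have h1 : Real.sqrt (A / n) ≤ 2 * Real.sqrt (A / (n + 1)) := by
    have : (2 : ℝ) * Real.sqrt (A / (n + 1)) = Real.sqrt (4 * (A / (n + 1))) := by
      rw [Real.sqrt_mul (by norm_num), show (4 : ℝ) = 2 ^ 2 by norm_num,
        Real.sqrt_sq (by norm_num)]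
    rw [this]
    refine Real.sqrt_le_sqrt ?_
    rw [← mul_div_assoc, div_le_div_iff₀ (by linarith) (by linarith)]
    nlinarith
  have h2 : C / n ≤ 2 * (C / (n + 1)) := by
    rw [← mul_div_assoc, div_le_div_iff₀ (by linarith) (by linarith)]
    nlinarith
  linarith

end Radius

/-- Before round `t` the average payoff of every pulled arm is within its confidence radius of the
mean; the inequality is multiplied by the number of pulls. -/
def Accurate (μ : X → ℝ) (T : ℕ) (δ C : ℝ) (x : ℕ → X) (y : ℕ → ℝ) (t : ℕ) : Prop :=
  ∀ v, 0 < pulls x v t →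
    |pullSum x y v t - pulls x v t * μ v| ≤ pulls x v t * radius T δ C (pulls x v t)

variable {μ : X → ℝ} {T : ℕ} {δ C : ℝ} {x : ℕ → X} {y : ℕ → ℝ} {t : ℕ}

/-- Corruptions of total size at most `C` move an average of `n` payoffs by at most `C / n`, so
that the averages are accurate as soon as the noise sums are of the expected order. -/
lemma accurate_of_noise {η c : ℕ → ℝ} (hy : ∀ t, y t = μ (x t) + η t + c t)
    (hc : ∑ t ∈ Finset.range T, |c t| ≤ C) (ht : t ≤ T)
    (hη : ∀ v, 0 < pulls x v t → |pullSum x η v t| ≤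
      Real.sqrt ((4 * Real.log T + 2 * Real.log (2 / δ)) * pulls x v t)) :
    Accurate μ T δ C x y t := by
  classical
  intro v hv
  have hn : (0 : ℝ) < pulls x v t := by exact_mod_cast hv
  have h1 : pullSum x y v t - pulls x v t * μ v = pullSum x η v t + pullSum x c v t := by
    have : pullSum x y v t = ∑ u ∈ (Finset.range t).filter (fun u => x u = v),
        (μ v + η u + c u) := by
      unfold pullSum
      refine Finset.sum_congr (by congr) fun u hu => ?_
      rw [hy, (Finset.mem_filter.1 hu).2]
    rw [this, Finset.sum_add_distrib, Finset.sum_add_distrib, Finset.sum_const, nsmul_eq_mul]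
    unfold pullSum pulls
    ring
  have h2 : |pullSum x c v t| ≤ C := by
    refine (Finset.abs_sum_le_sum_abs _ _).trans (le_trans ?_ hc)
    refine Finset.sum_le_sum_of_subset_of_nonneg ?_ fun _ _ _ => abs_nonneg _
    exact (Finset.filter_subset _ _).trans (Finset.range_mono ht)
  have h3 : (pulls x v t : ℝ) * radius T δ C (pulls x v t) =
      Real.sqrt ((4 * Real.log T + 2 * Real.log (2 / δ)) * pulls x v t) + C := by
    unfold radius
    set A := 4 * Real.log T + 2 * Real.log (2 / δ)
    set n : ℝ := (pulls x v t : ℝ)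
    rw [mul_add, mul_div_cancel₀ _ hn.ne', show A * n = n ^ 2 * (A / n) by field_simp,
      Real.sqrt_mul (by positivity), Real.sqrt_sq hn.le]
  rw [h1, h3]
  exact (abs_add_le _ _).trans (add_le_add (hη v hv) h2)

variable [MetricSpace X]

/-- What is maintained before round `t` as long as the averages are accurate: the memory `S` is
consistent with the history, an optimal arm survives, every pulled arm has a gap of the order of
its confidence radius, and distinct pulled arms are separated by the smaller of their radii. -/
structure Invariant (μ : X → ℝ) (T : ℕ) (δ C : ℝ) (x : ℕ → X) (y : ℕ → ℝ) (t : ℕ)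
    (S : State X) : Prop where
  count : ∀ v, S.count v = pulls x v t
  avg : ∀ v, S.avg v * pulls x v t = pullSum x y v t
  pos : ∀ v ∈ S.active, 0 < pulls x v t
  removed : ∀ v, 0 < pulls x v t → v ∉ S.active →
    ∀ z ∈ S.region, radius T δ C (pulls x v t) < dist z v
  sep : ∀ u v, 0 < pulls x u t → 0 < pulls x v t → u ≠ v →
    min (radius T δ C (pulls x u t)) (radius T δ C (pulls x v t)) < dist u v
  gap_le : ∀ v, 0 < pulls x v t → gap μ v ≤ 6 * radius T δ C (pulls x v t)
  opt : ∃ z, gap μ z ≤ 0 ∧ (z ∈ S.region ∨ z ∈ S.active)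

variable {S S' : State X}

lemma Invariant.abs_avg_sub_le (hI : Invariant μ T δ C x y t S) (hacc : Accurate μ T δ C x y t)
    {v : X} (hv : 0 < pulls x v t) : |S.avg v - μ v| ≤ radius T δ C (pulls x v t) := by
  have h := hacc v hv
  have hn : (0 : ℝ) < pulls x v t := by exact_mod_cast hv
  rw [← hI.avg v, show S.avg v * pulls x v t - pulls x v t * μ v =
    pulls x v t * (S.avg v - μ v) by ring, abs_mul, abs_of_pos hn] at h
  exact le_of_mul_le_mul_left h hn

lemma Invariant.init [Nonempty X] [CompactSpace X] (hμ : Continuous μ) :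
    Invariant μ T δ C x y 0 (State.init X) := by
  obtain ⟨z, hz⟩ := hμ.exists_forall_ge_of_hasCompactSupport
    (HasCompactSupport.of_compactSpace μ)
  refine ⟨fun v => by simp [pulls, State.init], fun v => by simp [pulls, pullSum, State.init],
    fun v hv => by simp [State.init] at hv, fun v hv => by simp [pulls] at hv,
    fun u v hu => by simp [pulls] at hu, fun v hv => by simp [pulls] at hv,
    z, ?_, Or.inl (Set.mem_univ _)⟩
  exact sub_nonpos.2 (ciSup_le hz)

/-- An optimal arm survives a removal: if it lies in the removed ball, then the dominating arm is
itself optimal, and it stays active. -/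
lemma Invariant.removal (hT : 2 ≤ T) (hδ0 : 0 < δ) (hδ1 : δ < 1) (hC : 0 ≤ C)
    (hlip : LipschitzWith 1 μ) (hI : Invariant μ T δ C x y t S)
    (hacc : Accurate μ T δ C x y t) (h : RemovalStep T δ C S S') :
    Invariant μ T δ C x y t S' := by
  rcases h with ⟨u, v, ⟨hu, hv, hdom⟩, rfl⟩ | ⟨-, rfl⟩
  swap
  · exact hI
  simp only [State.rad, hI.count] at hdom
  have hu0 := radius_pos hT hδ0 hδ1 hC (hI.pos u hu)
  have hv0 := radius_pos hT hδ0 hδ1 hC (hI.pos v hv)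
  have hne : v ≠ u := by
    rintro rfl
    linarith
  refine ⟨hI.count, hI.avg, fun w hw => hI.pos w hw.1, fun w hw hwa z hz => ?_, hI.sep,
    hI.gap_le, ?_⟩
  · by_cases hwu : w = u
    · subst hwu
      have := hz.2
      rw [Metric.mem_closedBall, not_le, State.rad, hI.count] at this
      exact this
    · exact hI.removed w hw (fun hw' => hwa ⟨hw', hwu⟩) z hz.1
  · obtain ⟨z, hz, hzS⟩ := hI.opt
    by_cases hzb : z ∈ Metric.closedBall u (S.rad T δ C u)
    · refine ⟨v, ?_, Or.inr ⟨hv, hne⟩⟩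
      rw [Metric.mem_closedBall, State.rad, hI.count] at hzb
      have h1 := abs_le.1 (hI.abs_avg_sub_le hacc (hI.pos u hu))
      have h2 := abs_le.1 (hI.abs_avg_sub_le hacc (hI.pos v hv))
      have h3 := hlip.dist_le_mul z u
      rw [NNReal.coe_one, one_mul, Real.dist_eq] at h3
      have h4 := (abs_le.1 h3).2
      unfold gap at hz ⊢
      linarith
    · refine ⟨z, hz, hzS.imp (fun h => ⟨h, hzb⟩) fun h => ⟨h, ?_⟩⟩
      rintro rfl
      refine hzb (Metric.mem_closedBall_self ?_)
      rw [State.rad, hI.count]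
      exact hu0.le

/-- An uncovered arm of the active region has not been pulled before, and it keeps its distance
from every arm pulled before, whether that arm is still active or has been removed. -/
lemma Invariant.lt_dist_of_uncovered (hI : Invariant μ T δ C x y t S) {z : X}
    (hz : z ∈ S.region) (hzc : z ∉ S.covered T δ C) {v : X} (hv : 0 < pulls x v t) :
    radius T δ C (pulls x v t) < dist z v := by
  by_cases hva : v ∈ S.active
  · by_contra hlt
    refine hzc (Set.mem_biUnion hva ?_)
    rw [Metric.mem_closedBall, State.rad, hI.count]
    exact not_lt.1 hlt
  · exact hI.removed v hv hva z hz

lemma Invariant.pulls_eq_zero_of_uncovered (hT : 2 ≤ T) (hδ0 : 0 < δ) (hδ1 : δ < 1) (hC : 0 ≤ C)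
    (hI : Invariant μ T δ C x y t S) {z : X}
    (hz : z ∈ S.region) (hzc : z ∉ S.covered T δ C) : pulls x z t = 0 := by
  by_contra hne
  have hpos := Nat.pos_of_ne_zero hne
  have := hI.lt_dist_of_uncovered hz hzc hpos
  rw [dist_self] at this
  exact absurd (radius_pos hT hδ0 hδ1 hC hpos) this.not_gt

lemma gap_le_one [CompactSpace X] (hdiam : ∀ a b : X, dist a b ≤ 1) (hlip : LipschitzWith 1 μ)
    (v : X) : gap μ v ≤ 1 := by
  have : Nonempty X := ⟨v⟩
  have : ⨆ z, μ z ≤ μ v + 1 := ciSup_le fun z => by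
    have h3 := hlip.dist_le_mul z v
    rw [NNReal.coe_one, one_mul, Real.dist_eq] at h3
    linarith [(abs_le.1 h3).2, hdiam z v]
  unfold gap
  linarith

/-- When the active region is covered, the pulled arm has a gap of at most three times its
confidence radius, because its index is at least the optimal mean. -/
lemma Invariant.gap_le_of_covered (hT : 2 ≤ T) (hδ0 : 0 < δ) (hδ1 : δ < 1) (hC : 0 ≤ C)
    (hlip : LipschitzWith 1 μ) (hI : Invariant μ T δ C x y t S)
    (hacc : Accurate μ T δ C x y t) (hcov : S.region ⊆ S.covered T δ C) {w : X}
    (hw : w ∈ S.active)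
    (hmax : ∀ v ∈ S.active, S.avg v + 2 * S.rad T δ C v ≤ S.avg w + 2 * S.rad T δ C w) :
    gap μ w ≤ 3 * radius T δ C (pulls x w t) := by
  obtain ⟨z, hz, hzS⟩ := hI.opt
  obtain ⟨v, hv, hzv⟩ : ∃ v ∈ S.active, dist z v ≤ radius T δ C (pulls x v t) := by
    rcases hzS with h | h
    · have := hcov h
      simp only [State.covered, Set.mem_iUnion, Metric.mem_closedBall, State.rad,
        hI.count] at this
      obtain ⟨v, hv, h⟩ := this
      exact ⟨v, hv, h⟩
    · refine ⟨z, h, ?_⟩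
      rw [dist_self]
      exact (radius_pos hT hδ0 hδ1 hC (hI.pos z h)).le
  have h1 := abs_le.1 (hI.abs_avg_sub_le hacc (hI.pos w hw))
  have h2 := abs_le.1 (hI.abs_avg_sub_le hacc (hI.pos v hv))
  have h3 := hlip.dist_le_mul z v
  rw [NNReal.coe_one, one_mul, Real.dist_eq] at h3
  have h4 := (abs_le.1 h3).2
  have h5 := hmax v hv
  simp only [State.rad, hI.count] at h5
  unfold gap at hz ⊢
  linarith

/-- The bookkeeping common to both ways of choosing the arm `x t`. Activation resets the entries
of an arm that has not been pulled before, so it leaves `count` and `avg` consistent. -/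
lemma Invariant.observe (hT : 2 ≤ T) (hδ0 : 0 < δ) (hδ1 : δ < 1) (hC : 0 ≤ C)
    (hI : Invariant μ T δ C x y t S)
    (hcount : ∀ v, S'.count v = pulls x v t)
    (havg : ∀ v, S'.avg v * pulls x v t = pullSum x y v t)
    (hact : S'.active = insert (x t) S.active) (hreg : S'.region = S.region)
    (hnew : pulls x (x t) t = 0 → ∀ v, 0 < pulls x v t →
      radius T δ C (pulls x v t) < dist (x t) v)
    (hgap : gap μ (x t) ≤ 6 * radius T δ C (pulls x (x t) t + 1)) :
    Invariant μ T δ C x y (t + 1) (S'.observe (x t) (y t)) := by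
  have hsucc : pulls x (x t) (t + 1) = pulls x (x t) t + 1 := pulls_succ_self rfl
  have hsep : ∀ v, 0 < pulls x v t → v ≠ x t → min (radius T δ C (pulls x (x t) (t + 1)))
      (radius T δ C (pulls x v (t + 1))) < dist (x t) v := by
    intro v hv hne
    rw [pulls_succ_of_ne hne.symm]
    rcases Nat.eq_zero_or_pos (pulls x (x t) t) with h0 | h0
    · exact (min_le_right _ _).trans_lt (hnew h0 v hv)
    · refine (min_le_min_right _ ?_).trans_lt (hI.sep (x t) v h0 hv hne.symm)
      exact radius_anti hT hδ0 hδ1 hC h0 (pulls_mono x _ t.le_succ)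
  refine ⟨fun v => ?_, fun v => ?_, fun v hv => ?_, fun v hv hva z hz => ?_,
    fun u v hu hv hne => ?_, fun v hv => ?_, ?_⟩
  · by_cases h : v = x t
    · subst h
      simp [State.observe, hsucc, hcount]
    · simp [State.observe, h, pulls_succ_of_ne (Ne.symm h), hcount]
  · by_cases h : v = x t
    · subst h
      have hne : ((pulls x (x t) t : ℝ) + 1) ≠ 0 := by positivity
      rw [pullSum_succ_self rfl, hsucc, ← havg]
      simp only [State.observe, hcount, Function.update_self]
      push_cast
      exact div_mul_cancel₀ _ hne
    · simp [State.observe, h, pulls_succ_of_ne (Ne.symm h), pullSum_succ_of_ne (Ne.symm h), havg]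
  · have hv' : v ∈ insert (x t) S.active := hact ▸ hv
    rcases hv' with rfl | hv'
    · omega
    · exact (hI.pos v hv').trans_le (pulls_mono x v t.le_succ)
  · have hva' : v ∉ insert (x t) S.active := hact ▸ hva
    have hne : x t ≠ v := fun h => hva' (Or.inl h.symm)
    rw [pulls_succ_of_ne hne] at hv ⊢
    exact hI.removed v hv (fun h => hva' (Or.inr h)) z (hreg ▸ hz)
  · by_cases h : u = x t
    · subst h
      rw [pulls_succ_of_ne hne] at hv
      exact hsep v hv hne.symm
    · rw [pulls_succ_of_ne (Ne.symm h)] at hu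
      by_cases h' : v = x t
      · subst h'
        rw [min_comm, dist_comm]
        exact hsep u hu h
      · rw [pulls_succ_of_ne (Ne.symm h')] at hv ⊢
        rw [pulls_succ_of_ne (Ne.symm h)]
        exact hI.sep u v hu hv hne
  · by_cases h : v = x t
    · subst h
      rw [hsucc]
      exact hgap
    · rw [pulls_succ_of_ne (Ne.symm h)] at hv ⊢
      exact hI.gap_le v hv
  · obtain ⟨z, hz, hzS⟩ := hI.opt
    refine ⟨z, hz, hzS.imp (fun h => ?_) fun h => ?_⟩
    · exact hreg.symm ▸ h
    · exact hact.symm ▸ Or.inr h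

lemma Invariant.round [CompactSpace X] (hT : 2 ≤ T) (hδ0 : 0 < δ) (hδ1 : δ < 1) (hC : 0 ≤ C)
    (hdiam : ∀ a b : X, dist a b ≤ 1) (hlip : LipschitzWith 1 μ)
    (hI : Invariant μ T δ C x y t S) (hacc : Accurate μ T δ C x y t)
    (h : Round T δ C S (x t) (y t) S') : Invariant μ T δ C x y (t + 1) S' := by
  obtain ⟨S₁, S₂, hrem, hch, rfl⟩ := h
  replace hI := hI.removal hT hδ0 hδ1 hC hlip hacc hrem
  rcases hch with ⟨-, hreg, hunc, rfl⟩ | ⟨hcov, hact, hmax, rfl⟩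
  · have h0 := hI.pulls_eq_zero_of_uncovered hT hδ0 hδ1 hC hreg hunc
    refine hI.observe hT hδ0 hδ1 hC (fun v => ?_) (fun v => ?_) rfl rfl
      (fun _ v hv => hI.lt_dist_of_uncovered hreg hunc hv) ?_
    · by_cases h : v = x t
      · subst h
        simp [State.activate, h0]
      · simp [State.activate, h, hI.count]
    · by_cases h : v = x t
      · subst h
        simp [h0, pullSum_eq_zero h0]
      · simp [State.activate, h, hI.avg]
    · rw [h0]
      linarith [gap_le_one hdiam hlip (x t), one_le_radius_one hT hδ0 hδ1 hC]
  · have hpos := hI.pos _ hact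
    refine hI.observe hT hδ0 hδ1 hC hI.count hI.avg (Set.insert_eq_of_mem hact).symm rfl
      (fun h => by omega) ?_
    linarith [hI.gap_le_of_covered hT hδ0 hδ1 hC hlip hacc hcov hact hmax,
      radius_le_two_mul_succ hT hδ0 hδ1 hC hpos]

lemma IsRun.exists_invariant [CompactSpace X] (hT : 2 ≤ T) (hδ0 : 0 < δ) (hδ1 : δ < 1)
    (hC : 0 ≤ C) (hdiam : ∀ a b : X, dist a b ≤ 1) (hlip : LipschitzWith 1 μ)
    (hrun : IsRun T δ C x y) (hacc : ∀ t ≤ T, Accurate μ T δ C x y t) :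
    ∃ S, Invariant μ T δ C x y T S := by
  obtain ⟨S, hS0, hS⟩ := hrun
  have : Nonempty X := ⟨x 0⟩
  have key : ∀ t ≤ T, Invariant μ T δ C x y t (S t) := by
    intro t
    induction t with
    | zero =>
      intro _
      rw [hS0]
      exact Invariant.init hlip.continuous
    | succ t ih =>
      intro ht
      exact (ih (by omega)).round hT hδ0 hδ1 hC hdiam hlip (hacc t (by omega)) (hS t ht)
  exact ⟨S T, key T le_rfl⟩

end Run

/-! ### Summation of the regret over the scales of the gap -/

section Scales

/-- Arms whose gaps lie in `(3 r / 4, r]` are more than `r / 8` apart, so each of the closed balls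
of radius `r / 16` counted by the zooming number contains at most one of them. The ratio `3 / 4`
between consecutive scales is what makes `(3 r / 4) / 6` reach the diameter `r / 8`. -/
lemma card_le_of_zoomingBound {X : Type*} [MetricSpace X] {μ : X → ℝ} {α d : ℝ}
    (hα : 0 < α) (hzoom : ZoomingBound μ α d) {V : Finset X} {rad : X → ℝ}
    (hsep : ∀ u ∈ V, ∀ v ∈ V, u ≠ v → min (rad u) (rad v) < dist u v)
    {r : ℝ} (hr0 : 0 < r) (hr1 : r ≤ 1) (hgap : ∀ v ∈ V, gap μ v ≤ 6 * rad v)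
    (hV : ∀ v ∈ V, 3 / 4 * r < gap μ v ∧ gap μ v ≤ r) :
    (V.card : ℝ) ≤ α * r ^ (-d) := by
  have hs : Metric.IsSeparated (2 * Real.toNNReal (r / 16) : ℝ≥0) (V : Set X) := by
    intro u hu v hv hne
    have h1 := hsep u hu v hv hne
    have h2 : r / 8 < dist u v := by
      refine lt_of_le_of_lt (le_min ?_ ?_) h1
      · linarith [hgap u hu, (hV u hu).1]
      · linarith [hgap v hv, (hV v hv).1]
    rw [edist_nndist, ENNReal.coe_lt_coe, ← NNReal.coe_lt_coe]
    push_cast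
    rw [Real.coe_toNNReal _ (by positivity)]
    linarith
  have h1 : ((V.card : ℕ) : ℕ∞) ≤ zoomingNumber μ r := by
    rw [← Set.encard_coe_eq_coe_finsetCard]
    exact (hs.encard_le_packingNumber fun v hv => (hV v hv).2).trans
      (Metric.packingNumber_two_mul_le_externalCoveringNumber _ _)
  have h2 : ((V.card : ℕ) : ℝ≥0∞) ≤ ENNReal.ofReal (α * r ^ (-d)) := by
    refine le_trans ?_ (hzoom r hr0 hr1)
    exact_mod_cast h1
  rwa [← ENNReal.ofReal_natCast, ENNReal.ofReal_le_ofReal_iff (by positivity)] at h2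

/-- Inverting the confidence radius: an arm with gap `g` of the order of its radius
`√(A / n) + C / n` contributes at most the order of `A / g + C` to the regret. -/
lemma mul_gap_le {A C g : ℝ} {n : ℕ} (hA : 0 ≤ A) (hC : 0 ≤ C) (hg : 0 < g) (hn : 0 < n)
    (h : g ≤ 6 * (Real.sqrt (A / n) + C / n)) : n * g ≤ 144 * A / g + 12 * C := by
  have hn' : (0 : ℝ) < n := by exact_mod_cast hn
  rcases le_total (g / 12) (Real.sqrt (A / n)) with h1 | h1
  · have h2 : (g / 12) ^ 2 ≤ A / n := by
      rw [← Real.sq_sqrt (show 0 ≤ A / n by positivity)]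
      gcongr
    rw [le_div_iff₀ hn'] at h2
    have h3 : n * g ≤ 144 * A / g := by
      rw [le_div_iff₀ hg]
      nlinarith
    linarith
  · have h2 : g / 12 ≤ C / n := by linarith
    rw [le_div_iff₀ hn'] at h2
    have : 0 ≤ 144 * A / g := by positivity
    linarith

/-- The regret is split at the gap `R`: smaller gaps cost at most `R` per round, and larger ones
are grouped by the scales `(3 / 4) ^ i`, `i ≤ m`. -/
lemma sum_mul_gap_le {ι : Type*} {V : Finset ι} {g : ι → ℝ} {n : ι → ℕ} {T α d A C R : ℝ}
    (hA : 0 ≤ A) (hC : 0 ≤ C) (hR : 0 < R)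
    (hn : ∑ v ∈ V, (n v : ℝ) ≤ T) (hg1 : ∀ v ∈ V, g v ≤ 1)
    (hcost : ∀ v ∈ V, 0 < g v → n v * g v ≤ 144 * A / g v + 12 * C)
    (hcard : ∀ r : ℝ, 0 < r → r ≤ 1 →
      ((V.filter fun v => 3 / 4 * r < g v ∧ g v ≤ r).card : ℝ) ≤ α * r ^ (-d))
    {m : ℕ} (hm : (3 / 4 : ℝ) ^ (m + 1) ≤ R) :
    ∑ v ∈ V, n v * g v ≤ T * R + ∑ i ∈ Finset.range (m + 1),
      α * ((3 / 4 : ℝ) ^ i) ^ (-d) * (192 * A / (3 / 4) ^ i + 12 * C) := by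
  classical
  have hlevel : ∀ v ∈ V.filter (fun v => ¬ g v ≤ R),
      ∃ i : ℕ, (3 / 4 : ℝ) ^ (i + 1) < g v ∧ g v ≤ (3 / 4) ^ i := fun v hv => by
    obtain ⟨hv, hvR⟩ := Finset.mem_filter.1 hv
    exact exists_nat_pow_near_of_lt_one (hR.trans (not_le.1 hvR)) (hg1 v hv) (by norm_num)
      (by norm_num)
  choose! lev hlev using hlevel
  rw [← Finset.sum_filter_add_sum_filter_not V fun v => g v ≤ R]
  refine add_le_add ?_ ?_
  · calc ∑ v ∈ V.filter (fun v => g v ≤ R), n v * g v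
        ≤ ∑ v ∈ V.filter (fun v => g v ≤ R), n v * R := by
          refine Finset.sum_le_sum fun v hv => ?_
          exact mul_le_mul_of_nonneg_left (Finset.mem_filter.1 hv).2 (Nat.cast_nonneg _)
      _ ≤ ∑ v ∈ V, n v * R := Finset.sum_le_sum_of_subset_of_nonneg (Finset.filter_subset _ _)
          fun _ _ _ => by positivity
      _ ≤ T * R := by
          rw [← Finset.sum_mul]
          exact mul_le_mul_of_nonneg_right hn hR.le
  · have hmaps : ∀ v ∈ V.filter (fun v => ¬ g v ≤ R), lev v ∈ Finset.range (m + 1) := by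
      intro v hv
      have h1 := (hlev v hv).2
      have h2 : R < g v := not_le.1 (Finset.mem_filter.1 hv).2
      rw [Finset.mem_range]
      exact (pow_lt_pow_iff_right_of_lt_one₀ (by norm_num) (by norm_num)).1
        ((hm.trans_lt h2).trans_le h1)
    rw [← Finset.sum_fiberwise_of_maps_to hmaps]
    refine Finset.sum_le_sum fun i _ => ?_
    set r : ℝ := (3 / 4) ^ i with hr
    have hr0 : 0 < r := by positivity
    have hr1 : r ≤ 1 := pow_le_one₀ (by norm_num) (by norm_num)
    have hsub : (V.filter (fun v => ¬ g v ≤ R)).filter (fun v => lev v = i) ⊆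
        V.filter fun v => 3 / 4 * r < g v ∧ g v ≤ r := by
      intro v hv
      obtain ⟨hv', hvi⟩ := Finset.mem_filter.1 hv
      have := hlev v hv'
      rw [hvi, pow_succ, mul_comm] at this
      exact Finset.mem_filter.2 ⟨(Finset.mem_filter.1 hv').1, this⟩
    calc _ ≤ ∑ v ∈ (V.filter (fun v => ¬ g v ≤ R)).filter (fun v => lev v = i),
          (192 * A / r + 12 * C) := by
          refine Finset.sum_le_sum fun v hv => ?_
          obtain ⟨hvV, h1, -⟩ := Finset.mem_filter.1 (hsub hv)
          have hg0 : 0 < g v := by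
            refine lt_trans ?_ h1
            positivity
          refine (hcost v hvV hg0).trans (add_le_add_left ?_ _)
          rw [div_le_div_iff₀ hg0 hr0]
          nlinarith
      _ ≤ α * r ^ (-d) * (192 * A / r + 12 * C) := by
          rw [Finset.sum_const, nsmul_eq_mul]
          refine mul_le_mul_of_nonneg_right ?_ (by positivity)
          refine le_trans ?_ (hcard r hr0 hr1)
          exact_mod_cast Finset.card_le_card hsub

/-- A geometric sum over the scales that are at least `R` is of the order of its last term. -/
lemma sum_scales_le {s R : ℝ} (hs : 0 < s) (hR : 0 < R) {m : ℕ} (hm : R ≤ (3 / 4 : ℝ) ^ m) :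
    ∑ i ∈ Finset.range (m + 1), ((3 / 4 : ℝ) ^ i) ^ (-s) ≤
      (4 / 3) ^ s / ((4 / 3) ^ s - 1) * R ^ (-s) := by
  set b : ℝ := (4 / 3) ^ s with hb
  have hb1 : 1 < b := Real.one_lt_rpow (by norm_num) hs
  have hpow : ∀ i : ℕ, ((3 / 4 : ℝ) ^ i) ^ (-s) = b ^ i := by
    intro i
    rw [Real.rpow_neg (by positivity), ← Real.inv_rpow (by positivity), ← inv_pow, hb,
      ← Real.rpow_natCast, ← Real.rpow_natCast, ← Real.rpow_mul (by norm_num),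
      ← Real.rpow_mul (by norm_num), mul_comm]
    norm_num
  have h1 : b ^ m ≤ R ^ (-s) := by
    rw [← hpow]
    exact Real.rpow_le_rpow_of_nonpos hR hm (by linarith)
  simp_rw [hpow]
  rw [geom_sum_eq hb1.ne', div_mul_eq_mul_div]
  refine div_le_div_of_nonneg_right ?_ (by linarith)
  rw [pow_succ]
  nlinarith

/-- In dimension zero every scale counts the same, and there are only logarithmically many. -/
lemma scales_card_le {T : ℝ} (hT : 2 ≤ T) {m : ℕ} (hm : 1 / T ≤ (3 / 4 : ℝ) ^ m) :
    (m : ℝ) + 1 ≤ 6 * Real.log T := by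
  have hT0 : 0 < T := by linarith
  have h1 := Real.log_le_log (by positivity) hm
  rw [Real.log_pow, one_div, Real.log_inv] at h1
  have h2 : Real.log (3 / 4) ≤ -(1 / 4) := by
    linarith [Real.log_le_sub_one_of_pos (show (0 : ℝ) < 3 / 4 by norm_num)]
  have h3 : Real.log 2 ≤ Real.log T := Real.log_le_log (by norm_num) hT
  have h4 := Real.log_two_gt_d9
  have hm0 : (0 : ℝ) ≤ m := Nat.cast_nonneg m
  nlinarith

/-- The threshold `R`, the larger of the two that balance the noise term and the corruption term
against `T * R`. -/
noncomputable def threshold (d T C : ℝ) : ℝ :=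
  max ((Real.log T / T) ^ (1 / (d + 2))) ((C / T) ^ (1 / (d + 1)))

section Threshold

variable {d T C : ℝ}

lemma mul_div_rpow {T a p : ℝ} (hT : 0 < T) (ha : 0 ≤ a) :
    T * (a / T) ^ p = a ^ p * T ^ (1 - p) := by
  rw [Real.div_rpow ha hT.le, Real.rpow_sub hT, Real.rpow_one]
  field_simp

lemma mul_rpow_neg_div {T a p : ℝ} (hT : 0 < T) (ha : 0 < a) :
    a * (a / T) ^ (-p) = a ^ (1 - p) * T ^ p := by
  rw [Real.rpow_neg (by positivity), Real.div_rpow ha.le hT.le, Real.rpow_sub ha, Real.rpow_one]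
  have := Real.rpow_pos_of_pos ha p
  have := Real.rpow_pos_of_pos hT p
  field_simp

lemma threshold_pos (hT : 2 ≤ T) : 0 < threshold d T C := by
  have : 0 < Real.log T := Real.log_pos (by linarith)
  exact lt_max_of_lt_left (Real.rpow_pos_of_pos (by positivity) _)

lemma mul_threshold_le (hd : 0 ≤ d) (hT : 2 ≤ T) (hC : 0 ≤ C) :
    T * threshold d T C ≤ Real.log T ^ (1 / (d + 2)) * T ^ ((d + 1) / (d + 2)) +
      C ^ (1 / (d + 1)) * T ^ (d / (d + 1)) := by
  have hT0 : 0 < T := by linarith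
  have hL : 0 < Real.log T := Real.log_pos (by linarith)
  have h1 : T * (Real.log T / T) ^ (1 / (d + 2)) =
      Real.log T ^ (1 / (d + 2)) * T ^ ((d + 1) / (d + 2)) := by
    rw [mul_div_rpow hT0 hL.le]
    congr 2
    field_simp
    ring
  have h2 : T * (C / T) ^ (1 / (d + 1)) = C ^ (1 / (d + 1)) * T ^ (d / (d + 1)) := by
    rw [mul_div_rpow hT0 hC]
    congr 2
    field_simp
    ring
  rw [← h1, ← h2, ← mul_add]
  refine mul_le_mul_of_nonneg_left (max_le_add_of_nonneg ?_ ?_) hT0.le <;> positivity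

lemma log_mul_threshold_rpow_le (hd : 0 ≤ d) (hT : 2 ≤ T) :
    Real.log T * threshold d T C ^ (-(d + 1)) ≤
      Real.log T ^ (1 / (d + 2)) * T ^ ((d + 1) / (d + 2)) := by
  have hT0 : 0 < T := by linarith
  have hL : 0 < Real.log T := Real.log_pos (by linarith)
  have h1 : threshold d T C ^ (-(d + 1)) ≤ ((Real.log T / T) ^ (1 / (d + 2))) ^ (-(d + 1)) :=
    Real.rpow_le_rpow_of_nonpos (Real.rpow_pos_of_pos (by positivity) _) (le_max_left _ _)
      (by linarith)
  refine (mul_le_mul_of_nonneg_left h1 hL.le).trans_eq ?_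
  rw [← Real.rpow_mul (by positivity), show 1 / (d + 2) * (-(d + 1)) = -((d + 1) / (d + 2)) by ring,
    mul_rpow_neg_div hT0 hL]
  congr 2
  field_simp
  ring

lemma mul_threshold_rpow_le (hd : 0 ≤ d) (hT : 2 ≤ T) (hC : 0 ≤ C) :
    C * threshold d T C ^ (-d) ≤ C ^ (1 / (d + 1)) * T ^ (d / (d + 1)) := by
  have hT0 : 0 < T := by linarith
  rcases hC.eq_or_lt with rfl | hC
  · rw [zero_mul]
    positivity
  have h1 : threshold d T C ^ (-d) ≤ ((C / T) ^ (1 / (d + 1))) ^ (-d) :=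
    Real.rpow_le_rpow_of_nonpos (Real.rpow_pos_of_pos (by positivity) _) (le_max_right _ _)
      (by linarith)
  refine (mul_le_mul_of_nonneg_left h1 hC.le).trans_eq ?_
  rw [← Real.rpow_mul (by positivity), show 1 / (d + 1) * (-d) = -(d / (d + 1)) by ring,
    mul_rpow_neg_div hT0 hC]
  congr 2
  field_simp
  ring

lemma one_div_le_threshold (hd : 0 ≤ d) (hT : 2 ≤ T) : 1 / T ≤ threshold d T C := by
  have hT0 : 0 < T := by linarith
  have hL : 1 / 2 ≤ Real.log T :=
    le_trans (by linarith [Real.log_two_gt_d9]) (Real.log_le_log (by norm_num) hT)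
  refine le_trans ?_ (le_max_left _ _)
  have h1 : 1 / T ^ 2 ≤ Real.log T / T := by
    rw [div_le_div_iff₀ (by positivity) hT0]
    nlinarith [mul_le_mul_of_nonneg_right hL hT0.le]
  calc 1 / T = (1 / T ^ 2) ^ (1 / 2 : ℝ) := by
        rw [← Real.sqrt_eq_rpow, ← one_div_pow, Real.sqrt_sq (by positivity)]
    _ ≤ (1 / T ^ 2) ^ (1 / (d + 2)) := by
        refine Real.rpow_le_rpow_of_exponent_ge (by positivity) ?_ ?_
        · rw [div_le_one (by positivity)]
          nlinarith
        · exact one_div_le_one_div_of_le (by norm_num) (by linarith)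
    _ ≤ _ := Real.rpow_le_rpow (by positivity) h1 (by positivity)

lemma half_le_ite_log (hT : 2 ≤ T) : 1 / 2 ≤ (if d = 0 then Real.log T else 1) := by
  have hL : 1 / 2 ≤ Real.log T :=
    le_trans (by linarith [Real.log_two_gt_d9]) (Real.log_le_log (by norm_num) hT)
  split_ifs <;> linarith

/-- The corruption term summed over the scales: a geometric sum in positive dimension, and a
number of equal terms that is logarithmic in `T` in dimension zero. -/
lemma mul_sum_scales_le (hd : 0 ≤ d) (hT : 2 ≤ T) (hC : 0 ≤ C) {m : ℕ}
    (hm : threshold d T C ≤ (3 / 4 : ℝ) ^ m) :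
    C * ∑ i ∈ Finset.range (m + 1), ((3 / 4 : ℝ) ^ i) ^ (-d) ≤
      (6 + (4 / 3) ^ d / ((4 / 3) ^ d - 1)) *
        ((if d = 0 then Real.log T else 1) * (C ^ (1 / (d + 1)) * T ^ (d / (d + 1)))) := by
  rcases hd.eq_or_lt with rfl | hd
  · have h1 := scales_card_le hT ((one_div_le_threshold le_rfl hT).trans hm)
    have h2 := mul_le_mul_of_nonneg_left h1 hC
    -- here the geometric constant is `1 / 0 = 0`, and the summand `6` does the work
    simp
    linarith
  · rw [if_neg hd.ne', one_mul]
    have hb : 1 < (4 / 3 : ℝ) ^ d := Real.one_lt_rpow (by norm_num) hd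
    have hG : 0 ≤ (4 / 3 : ℝ) ^ d / ((4 / 3) ^ d - 1) :=
      div_nonneg (by linarith) (by linarith)
    have h1 := mul_le_mul_of_nonneg_left (sum_scales_le hd (threshold_pos hT) hm) hC
    have h2 := mul_le_mul_of_nonneg_left (mul_threshold_rpow_le hd.le hT hC) hG
    have h3 : 0 ≤ C ^ (1 / (d + 1)) * T ^ (d / (d + 1)) := by positivity
    linarith

/-- The constant in front of the regret bound, where `a` is the ratio between the logarithmic term
of the confidence radius and `log T`. -/
noncomputable def regretConst (d α a : ℝ) : ℝ :=
  2 + 192 * α * a * ((4 / 3) ^ (d + 1) / ((4 / 3) ^ (d + 1) - 1)) +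
    12 * α * (6 + (4 / 3) ^ d / ((4 / 3) ^ d - 1))

lemma two_le_regretConst {α a : ℝ} (hd : 0 ≤ d) (hα : 0 < α) (ha : 0 ≤ a) :
    2 ≤ regretConst d α a := by
  have h1 : 1 ≤ (4 / 3 : ℝ) ^ (d + 1) := Real.one_le_rpow (by norm_num) (by linarith)
  have h2 : 1 ≤ (4 / 3 : ℝ) ^ d := Real.one_le_rpow (by norm_num) hd
  have h3 : 0 ≤ (4 / 3 : ℝ) ^ (d + 1) - 1 := by linarith
  have h4 : 0 ≤ (4 / 3 : ℝ) ^ d - 1 := by linarith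
  unfold regretConst
  rw [add_assoc]
  exact le_add_of_nonneg_right (by positivity)

/-- The sum over the scales, at the threshold, in terms of the two rates of the regret bound. -/
lemma threshold_sum_le {α a A : ℝ} (hd : 0 ≤ d) (hα : 0 < α) (ha : 0 ≤ a)
    (hAa : A ≤ a * Real.log T) (hT : 2 ≤ T) (hC : 0 ≤ C) {m : ℕ}
    (hm : threshold d T C ≤ (3 / 4 : ℝ) ^ m) :
    T * threshold d T C + ∑ i ∈ Finset.range (m + 1),
      α * ((3 / 4 : ℝ) ^ i) ^ (-d) * (192 * A / (3 / 4) ^ i + 12 * C) ≤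
    regretConst d α a * (Real.log T ^ (1 / (d + 2)) * T ^ ((d + 1) / (d + 2)) +
      (if d = 0 then Real.log T else 1) * (C ^ (1 / (d + 1)) * T ^ (d / (d + 1)))) := by
  have hT0 : 0 < T := by linarith
  have hL : 0 < Real.log T := Real.log_pos (by linarith)
  have hsum : ∑ i ∈ Finset.range (m + 1),
      α * ((3 / 4 : ℝ) ^ i) ^ (-d) * (192 * A / (3 / 4) ^ i + 12 * C) =
      192 * α * (A * ∑ i ∈ Finset.range (m + 1), ((3 / 4 : ℝ) ^ i) ^ (-(d + 1))) +
      12 * α * (C * ∑ i ∈ Finset.range (m + 1), ((3 / 4 : ℝ) ^ i) ^ (-d)) := by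
    simp only [Finset.mul_sum]
    rw [← Finset.sum_add_distrib]
    refine Finset.sum_congr rfl fun i _ => ?_
    have hr : (0 : ℝ) < (3 / 4) ^ i := by positivity
    rw [neg_add, ← sub_eq_add_neg, Real.rpow_sub hr, Real.rpow_one]
    ring
  have hG : 0 ≤ (4 / 3 : ℝ) ^ (d + 1) / ((4 / 3) ^ (d + 1) - 1) := by
    have h1 : 1 ≤ (4 / 3 : ℝ) ^ (d + 1) := Real.one_le_rpow (by norm_num) (by linarith)
    exact div_nonneg (by linarith) (by linarith)
  have hnoise : A * ∑ i ∈ Finset.range (m + 1), ((3 / 4 : ℝ) ^ i) ^ (-(d + 1)) ≤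
      a * ((4 / 3) ^ (d + 1) / ((4 / 3) ^ (d + 1) - 1)) *
        (Real.log T ^ (1 / (d + 2)) * T ^ ((d + 1) / (d + 2))) := by
    have h1 := sum_scales_le (show 0 < d + 1 by linarith) (threshold_pos (C := C) hT) hm
    have h2 := log_mul_threshold_rpow_le (C := C) hd hT
    calc _ ≤ a * Real.log T * ((4 / 3) ^ (d + 1) / ((4 / 3) ^ (d + 1) - 1) *
          threshold d T C ^ (-(d + 1))) :=
          mul_le_mul hAa h1 (Finset.sum_nonneg fun i _ => by positivity) (by positivity)
      _ = a * ((4 / 3) ^ (d + 1) / ((4 / 3) ^ (d + 1) - 1)) *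
          (Real.log T * threshold d T C ^ (-(d + 1))) := by ring
      _ ≤ _ := mul_le_mul_of_nonneg_left h2 (by positivity)
  have hcor := mul_sum_scales_le hd hT hC hm
  have hTR := mul_threshold_le hd hT hC
  have hlam := half_le_ite_log (d := d) hT
  have hB2 : 0 ≤ C ^ (1 / (d + 1)) * T ^ (d / (d + 1)) := by positivity
  have hB1 : 0 ≤ Real.log T ^ (1 / (d + 2)) * T ^ ((d + 1) / (d + 2)) := by positivity
  have hG' : 0 ≤ 6 + (4 / 3 : ℝ) ^ d / ((4 / 3) ^ d - 1) := by
    have h1 : 1 ≤ (4 / 3 : ℝ) ^ d := Real.one_le_rpow (by norm_num) hd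
    have : 0 ≤ (4 / 3 : ℝ) ^ d / ((4 / 3) ^ d - 1) := div_nonneg (by linarith) (by linarith)
    linarith
  rw [hsum]
  unfold regretConst
  generalize Real.log T ^ (1 / (d + 2)) * T ^ ((d + 1) / (d + 2)) = B₁ at *
  generalize C ^ (1 / (d + 1)) * T ^ (d / (d + 1)) = B₂ at *
  generalize (if d = 0 then Real.log T else 1) = lam at *
  generalize (4 / 3 : ℝ) ^ (d + 1) / ((4 / 3) ^ (d + 1) - 1) = G at *
  generalize 6 + (4 / 3 : ℝ) ^ d / ((4 / 3) ^ d - 1) = G' at *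
  have h1 := mul_le_mul_of_nonneg_left hnoise (show 0 ≤ 192 * α by positivity)
  have h2 := mul_le_mul_of_nonneg_left hcor (show 0 ≤ 12 * α by positivity)
  have h3 := mul_le_mul_of_nonneg_right hlam hB2
  have h4 : 0 ≤ 192 * α * a * G * (lam * B₂) := by
    have : 0 ≤ lam := by linarith
    positivity
  have h5 : 0 ≤ 12 * α * G' * B₁ := by positivity
  linarith

end Threshold

end Scales

/-! ### Regret of a run on the event of accurate averages -/

section Regret

variable {X : Type*} {μ : X → ℝ} {x : ℕ → X} {T : ℕ}

lemma regret_eq_sum_gap : regret μ x T = ∑ t ∈ Finset.range T, gap μ (x t) := by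
  simp [regret, gap]

open Classical in
lemma regret_eq_sum_pulls : regret μ x T =
    ∑ v ∈ (Finset.range T).image x, (pulls x v T : ℝ) * gap μ v := by
  rw [regret_eq_sum_gap, Finset.sum_comp (gap μ) x]
  simp [pulls]

open Classical in
lemma sum_pulls : ∑ v ∈ (Finset.range T).image x, (pulls x v T : ℝ) = T := by
  have := Finset.sum_comp (s := Finset.range T) (fun _ : X => (1 : ℝ)) x
  simp only [Finset.sum_const, Finset.card_range, nsmul_eq_mul, mul_one] at this
  exact this.symm

/-- The log factor of the confidence radius is of the order of `log T`. -/
lemma logTerm_le {δ : ℝ} (hT : 2 ≤ T) (hδ0 : 0 < δ) (hδ1 : δ < 1) :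
    4 * Real.log T + 2 * Real.log (2 / δ) ≤
      (4 + 2 * Real.log (2 / δ) / Real.log 2) * Real.log T := by
  have h1 : Real.log 2 ≤ Real.log T := Real.log_le_log (by norm_num) (by exact_mod_cast hT)
  have h2 : 0 ≤ Real.log (2 / δ) := Real.log_nonneg (by rw [le_div_iff₀ hδ0]; linarith)
  have h3 : 0 < Real.log 2 := Real.log_pos (by norm_num)
  have h4 : 2 * Real.log (2 / δ) ≤ 2 * Real.log (2 / δ) / Real.log 2 * Real.log T := by
    rw [div_mul_eq_mul_div, le_div_iff₀ h3]
    exact mul_le_mul_of_nonneg_left h1 (by positivity)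
  linarith

lemma Invariant.regret_le [MetricSpace X] [CompactSpace X] {α d δ C : ℝ} {y : ℕ → ℝ} {S : State X}
    (hd : 0 ≤ d) (hα : 0 < α) (hδ0 : 0 < δ) (hδ1 : δ < 1) (hT : 2 ≤ T) (hC : 0 ≤ C)
    (hdiam : ∀ a b : X, dist a b ≤ 1) (hlip : LipschitzWith 1 μ) (hzoom : ZoomingBound μ α d)
    (hI : Invariant μ T δ C x y T S) :
    regret μ x T ≤ regretConst d α (4 + 2 * Real.log (2 / δ) / Real.log 2) *
      (Real.log T ^ (1 / (d + 2)) * (T : ℝ) ^ ((d + 1) / (d + 2)) +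
        (if d = 0 then Real.log T else 1) *
          (C ^ (1 / (d + 1)) * (T : ℝ) ^ (d / (d + 1)))) := by
  classical
  have hT' : (2 : ℝ) ≤ T := by exact_mod_cast hT
  have hT0 : (0 : ℝ) < T := by linarith
  have hR := threshold_pos (d := d) (C := C) hT'
  have ha : 0 ≤ 4 + 2 * Real.log (2 / δ) / Real.log 2 := by
    have h2 : 0 ≤ Real.log (2 / δ) := Real.log_nonneg (by rw [le_div_iff₀ hδ0]; linarith)
    positivity
  have hlam := half_le_ite_log (d := d) hT'
  have hL : 0 < Real.log T := Real.log_pos (by linarith)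
  have hB1 : 0 ≤ Real.log T ^ (1 / (d + 2)) * (T : ℝ) ^ ((d + 1) / (d + 2)) := by positivity
  have hB2 : 0 ≤ C ^ (1 / (d + 1)) * (T : ℝ) ^ (d / (d + 1)) := by positivity
  rcases le_or_gt (threshold d T C) 1 with hR1 | hR1
  · obtain ⟨m, hm1, hm2⟩ := exists_nat_pow_near_of_lt_one hR hR1
      (show (0 : ℝ) < 3 / 4 by norm_num) (by norm_num)
    have hpulls : ∀ v ∈ (Finset.range T).image x, 0 < pulls x v T := by
      intro v hv
      obtain ⟨t, ht, rfl⟩ := Finset.mem_image.1 hv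
      exact Finset.card_pos.2 ⟨t, Finset.mem_filter.2 ⟨ht, rfl⟩⟩
    have hA := two_le_logTerm hT hδ0 hδ1
    refine le_trans ?_ (threshold_sum_le hd hα ha (logTerm_le hT hδ0 hδ1) hT' hC hm2)
    rw [regret_eq_sum_pulls]
    refine sum_mul_gap_le (by linarith) hC hR sum_pulls.le
      (fun v _ => gap_le_one hdiam hlip v) (fun v hv hg => ?_) (fun r hr0 hr1 => ?_) hm1.le
    · exact mul_gap_le (by linarith) hC hg (hpulls v hv) (hI.gap_le v (hpulls v hv))
    · refine card_le_of_zoomingBound hα hzoom (rad := fun v => radius T δ C (pulls x v T))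
        (fun u hu v hv hne => ?_) hr0 hr1 (fun v hv => ?_) fun v hv => (Finset.mem_filter.1 hv).2
      · exact hI.sep u v (hpulls u (Finset.mem_filter.1 hu).1)
          (hpulls v (Finset.mem_filter.1 hv).1) hne
      · exact hI.gap_le v (hpulls v (Finset.mem_filter.1 hv).1)
  · -- a threshold above `1` exceeds every gap, and the trivial bound `T` suffices
    have h1 : regret μ x T ≤ T := by
      rw [regret_eq_sum_gap]
      refine (Finset.sum_le_sum fun t _ => gap_le_one hdiam hlip (x t)).trans ?_
      simp
    have h2 := mul_threshold_le hd hT' hC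
    have h3 := two_le_regretConst hd hα ha
    have h4 := mul_le_mul_of_nonneg_left hR1.le hT0.le
    have h5 := mul_le_mul_of_nonneg_right hlam hB2
    refine le_trans ?_ (mul_le_mul_of_nonneg_right h3 (by positivity))
    linarith

end Regret

/-! ### The event of accurate averages is likely -/

section CleanEvent

variable {Ω X : Type*} {x : ℕ → Ω → X} {η : ℕ → Ω → ℝ}

/-- The event that round `u` is one of the first `n` pulls of the arm `x s`, where `s` is meant to
be the round of the first pull of that arm. It is known before the noise of round `u` is drawn.
Naming the arm by the round `s` leaves only finitely many events to control. -/
def earlyPull (x : ℕ → Ω → X) (s n u : ℕ) : Set Ω :=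
  {ω | s ≤ u ∧ x u ω = x s ω ∧ pulls (fun t => x t ω) (x s ω) u < n}

/-- The event that the noise sum over the first `n` pulls of the arm `x s` is exceptionally large,
where `a` is the logarithmic term of the confidence radius. -/
def noisyEvent (x : ℕ → Ω → X) (η : ℕ → Ω → ℝ) (T : ℕ) (a : ℝ) (s n : ℕ) : Set Ω :=
  {ω | ∑ u ∈ Finset.range T, (earlyPull x s n u).indicator (fun _ => (1 : ℝ)) ω = n ∧
    Real.sqrt (a * n) <
      |∑ u ∈ Finset.range T, (earlyPull x s n u).indicator (η u) ω|}

section Measurability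

variable [MeasurableSpace X]

lemma measurable_arm_history {t w : ℕ} (h : w ≤ t) : Measurable[history x η t] (x w) :=
  measurable_iff_comap_le.2 <| (le_iSup₂ (f := fun s (_ : s ∈ Set.Iic t) =>
    MeasurableSpace.comap (x s) inferInstance) w h).trans le_sup_left

lemma measurable_noise_history {t w : ℕ} (h : w < t) : Measurable[history x η t] (η w) :=
  measurable_iff_comap_le.2 <| (le_iSup₂ (f := fun s (_ : s ∈ Set.Iio t) =>
    MeasurableSpace.comap (η s) inferInstance) w h).trans le_sup_right

lemma history_le [mΩ : MeasurableSpace Ω] {T t : ℕ} (hx : ∀ t < T, Measurable (x t))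
    (hη : ∀ t < T, Measurable (η t)) (ht : t < T) : history x η t ≤ mΩ :=
  sup_le (iSup₂_le fun s hs => (hx s (lt_of_le_of_lt hs ht)).comap_le)
    (iSup₂_le fun s hs => (hη s (lt_trans hs ht)).comap_le)

lemma measurableSet_earlyPull [MeasurableEq X] {s n u t : ℕ} (hut : u ≤ t) :
    MeasurableSet[history x η t] (earlyPull x s n u) := by
  classical
  by_cases hsu : s ≤ u
  · have hxm : ∀ w ≤ u, Measurable[history x η t] (x w) := fun w hw =>
      measurable_arm_history (hw.trans hut)
    have h1 : MeasurableSet[history x η t] {ω | x u ω = x s ω} :=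
      measurableSet_eq_fun (hxm u le_rfl) (hxm s hsu)
    have h2 : Measurable[history x η t] fun ω => pulls (fun t => x t ω) (x s ω) u := by
      have : (fun ω => pulls (fun t => x t ω) (x s ω) u) =
          fun ω => ∑ w ∈ Finset.range u, if x w ω = x s ω then 1 else 0 := by
        ext ω
        rw [pulls, Finset.card_filter]
      rw [this]
      refine Finset.measurable_fun_sum _ fun w hw => ?_
      refine Measurable.ite ?_ measurable_const measurable_const
      exact measurableSet_eq_fun (hxm w (Finset.mem_range.1 hw).le) (hxm s hsu)
    have h3 : earlyPull x s n u = {ω | x u ω = x s ω} ∩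
        (fun ω => pulls (fun t => x t ω) (x s ω) u) ⁻¹' Set.Iio n := by
      ext ω
      simp [earlyPull, hsu]
    rw [h3]
    exact MeasurableSet.inter h1 (h2 measurableSet_Iio)
  · have : earlyPull x s n u = ∅ := by
      ext ω
      simp [earlyPull, hsu]
    rw [this]
    exact @MeasurableSet.empty Ω (history x η t)

/-- The union bound over the `T` possible rounds of a first pull and the `T` possible numbers of
pulls. -/
lemma measure_noisyEvents_le [MeasurableEq X] [MeasurableSpace Ω] {P : Measure Ω}
    [IsProbabilityMeasure P] {T : ℕ} {δ : ℝ} (hT : 2 ≤ T) (hδ0 : 0 < δ) (hδ1 : δ < 1)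
    (hx : ∀ t < T, Measurable (x t)) (hη : ∀ t < T, Measurable (η t))
    (hsub : ∀ t < T, CondSubgaussian P (history x η t) (η t) 1) :
    P (⋃ s ∈ Finset.range T, ⋃ n ∈ Finset.Icc 1 T,
      noisyEvent x η T (4 * Real.log T + 2 * Real.log (2 / δ)) s n) ≤ ENNReal.ofReal δ := by
  have hA := two_le_logTerm hT hδ0 hδ1
  have hT0 : (0 : ℝ) < T := by positivity
  set a := 4 * Real.log T + 2 * Real.log (2 / δ) with ha
  have hexp : 2 * Real.exp (-(a / 2)) = δ / (T * T) := by
    have : -(a / 2) = -(Real.log T + Real.log T + Real.log (2 / δ)) := by rw [ha]; ring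
    rw [this, Real.exp_neg, Real.exp_add, Real.exp_add, Real.exp_log hT0,
      Real.exp_log (by positivity)]
    field_simp
  have hone : ∀ s, ∀ n ∈ Finset.Icc 1 T,
      P (noisyEvent x η T a s n) ≤ ENNReal.ofReal (δ / (T * T)) := by
    intro s n hn
    rw [← hexp]
    exact measure_selected_noise_le (H := history x η) (fun t ht => history_le hx hη ht) hη
      (fun t _ u hu => measurable_noise_history hu)
      (fun t _ u hu => measurableSet_earlyPull hu) hsub (Finset.mem_Icc.1 hn).1 (by linarith)
  calc _ ≤ ∑ s ∈ Finset.range T, P (⋃ n ∈ Finset.Icc 1 T, noisyEvent x η T a s n) :=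
        measure_biUnion_finset_le _ _
    _ ≤ ∑ s ∈ Finset.range T, ∑ n ∈ Finset.Icc 1 T, P (noisyEvent x η T a s n) :=
        Finset.sum_le_sum fun s _ => measure_biUnion_finset_le _ _
    _ ≤ ∑ s ∈ Finset.range T, ∑ n ∈ Finset.Icc 1 T, ENNReal.ofReal (δ / (T * T)) :=
        Finset.sum_le_sum fun s _ => Finset.sum_le_sum (hone s)
    _ = ENNReal.ofReal δ := by
        simp only [Finset.sum_const, Finset.card_range, Nat.card_Icc, add_tsub_cancel_right,
          nsmul_eq_mul]
        rw [← ENNReal.ofReal_natCast, ← ENNReal.ofReal_mul hT0.le, ← ENNReal.ofReal_mul hT0.le]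
        congr 1
        field_simp

end Measurability

/-- If `s` is the round of the first pull of `v`, then the first `pulls v t` pulls of `x s` are
exactly the pulls of `v` before round `t`. -/
lemma sum_indicator_earlyPull {ω : Ω} {v : X} {s t T : ℕ} (hs : x s ω = v)
    (hmin : ∀ u < s, x u ω ≠ v) (ht : t ≤ T) (f : ℕ → Ω → ℝ) :
    ∑ u ∈ Finset.range T,
        (earlyPull x s (pulls (fun t => x t ω) v t) u).indicator (f u) ω =
      pullSum (fun t => x t ω) (fun t => f t ω) v t := by
  classical
  have hmem : ∀ u, ω ∈ earlyPull x s (pulls (fun t => x t ω) v t) u ↔ u < t ∧ x u ω = v := by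
    intro u
    simp only [earlyPull, Set.mem_ofPred_eq, hs]
    constructor
    · rintro ⟨-, h1, h2⟩
      exact ⟨lt_of_not_ge fun h => absurd (pulls_mono _ v h) h2.not_ge, h1⟩
    · rintro ⟨h1, h2⟩
      refine ⟨not_lt.1 fun h => hmin u h h2, h2, ?_⟩
      have h3 : pulls (fun t => x t ω) v (u + 1) ≤ pulls (fun t => x t ω) v t :=
        pulls_mono _ v h1
      rw [pulls_succ_self h2] at h3
      omega
  have hset : (Finset.range t).filter (fun u => x u ω = v) =
      (Finset.range T).filter fun u => u < t ∧ x u ω = v := by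
    ext u
    simp only [Finset.mem_filter, Finset.mem_range]
    constructor
    · rintro ⟨h1, h2⟩
      exact ⟨h1.trans_le ht, h1, h2⟩
    · rintro ⟨-, h⟩
      exact h
  have hsum : pullSum (fun t => x t ω) (fun t => f t ω) v t =
      ∑ u ∈ (Finset.range t).filter (fun u => x u ω = v), f u ω :=
    Finset.sum_congr (by congr) fun _ _ => rfl
  rw [hsum, hset, Finset.sum_filter]
  refine Finset.sum_congr rfl fun u _ => ?_
  by_cases h : u < t ∧ x u ω = v
  · rw [if_pos h, Set.indicator_of_mem ((hmem u).2 h)]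
  · rw [if_neg h, Set.indicator_of_notMem fun h' => h ((hmem u).1 h')]

lemma abs_pullSum_le_of_notMem_noisyEvent {ω : Ω} {T : ℕ} {a : ℝ}
    (hω : ∀ s < T, ∀ n, 1 ≤ n → n ≤ T → ω ∉ noisyEvent x η T a s n) {t : ℕ} (ht : t ≤ T) {v : X}
    (hv : 0 < pulls (fun t => x t ω) v t) :
    |pullSum (fun t => x t ω) (fun t => η t ω) v t| ≤
      Real.sqrt (a * pulls (fun t => x t ω) v t) := by
  classical
  have hex : ∃ u, x u ω = v ∧ u < t := by
    obtain ⟨u, hu⟩ := Finset.card_pos.1 hv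
    obtain ⟨h1, h2⟩ := Finset.mem_filter.1 hu
    exact ⟨u, h2, Finset.mem_range.1 h1⟩
  obtain ⟨hs, hst⟩ := Nat.find_spec hex
  have hmin : ∀ u < Nat.find hex, x u ω ≠ v := fun u hu h =>
    Nat.find_min hex hu ⟨h, hu.trans hst⟩
  have hle : pulls (fun t => x t ω) v t ≤ T := by
    refine (Finset.card_filter_le _ _).trans ?_
    rwa [Finset.card_range]
  have hnot := hω (Nat.find hex) (hst.trans_le ht) _ hv hle
  rw [noisyEvent, Set.mem_ofPred_eq, sum_indicator_earlyPull hs hmin ht η,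
    sum_indicator_earlyPull hs hmin ht fun _ _ => 1] at hnot
  refine not_lt.1 fun h => hnot ⟨?_, h⟩
  simp [pullSum, pulls]

end CleanEvent

end RobustZooming

/-- The rounds are `t = 0, …, T - 1`. In round `t` the arm `x t` is pulled, `η t` is the noise and
`c t` is the corruption that the strong adversary adds to the payoff of the pulled arm. -/
theorem theorem1 (d α δ : ℝ) (hα : 0 < α) (hδ0 : 0 < δ) (hδ1 : δ < 1) :
    ∃ K : ℝ, 0 < K ∧
      ∀ (X : Type*) [MetricSpace X] [CompactSpace X] [MeasurableSpace X] [BorelSpace X]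
        (μ : X → ℝ),
        (∀ a b : X, dist a b ≤ 1) → LipschitzWith 1 μ →
        RobustZooming.IsZoomingDimension μ d → RobustZooming.ZoomingBound μ α d →
      ∀ (T : ℕ) (C : ℝ), 2 ≤ T → 0 ≤ C →
      ∀ (Ω : Type*) [MeasurableSpace Ω] (P : Measure Ω) [IsProbabilityMeasure P]
        (x : ℕ → Ω → X) (η c : ℕ → Ω → ℝ),
        (∀ t < T, Measurable (x t)) → (∀ t < T, Measurable (η t)) →
        (∀ t < T, RobustZooming.CondSubgaussian P (RobustZooming.history x η t) (η t) 1) →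
        (∀ᵐ ω ∂P, ∑ t ∈ Finset.range T, |c t ω| ≤ C) →
        (∀ᵐ ω ∂P, RobustZooming.IsRun T δ C (fun t => x t ω)
          (fun t => μ (x t ω) + η t ω + c t ω)) →
        ENNReal.ofReal (1 - δ) ≤
          P {ω | RobustZooming.regret μ (fun t => x t ω) T ≤
            K * (Real.log T ^ (1 / (d + 2)) * (T : ℝ) ^ ((d + 1) / (d + 2)) +
              (if d = 0 then Real.log T else 1) *
                (C ^ (1 / (d + 1)) * (T : ℝ) ^ (d / (d + 1))))} := by
  rcases lt_or_ge d 0 with hd | hd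
  · -- no space has a negative zooming dimension
    refine ⟨1, one_pos, fun X _ _ _ _ μ _ _ hdim => ?_⟩
    exact absurd hdim.1.1 (not_le.2 hd)
  have ha : 0 ≤ 4 + 2 * Real.log (2 / δ) / Real.log 2 := by
    have h2 : 0 ≤ Real.log (2 / δ) := Real.log_nonneg (by rw [le_div_iff₀ hδ0]; linarith)
    positivity
  refine ⟨RobustZooming.regretConst d α (4 + 2 * Real.log (2 / δ) / Real.log 2),
    by linarith [RobustZooming.two_le_regretConst hd hα ha], ?_⟩
  intro X _ _ _ _ μ hdiam hlip _ hzoom T C hT hC Ω _ P _ x η c hx hη hsub hc hrun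
  have hbad := RobustZooming.measure_noisyEvents_le hT hδ0 hδ1 hx hη hsub
  set B := ⋃ s ∈ Finset.range T, ⋃ n ∈ Finset.Icc 1 T, RobustZooming.noisyEvent x η T
    (4 * Real.log T + 2 * Real.log (2 / δ)) s n with hB
  set G := {ω | RobustZooming.regret μ (fun t => x t ω) T ≤
    RobustZooming.regretConst d α (4 + 2 * Real.log (2 / δ) / Real.log 2) *
      (Real.log T ^ (1 / (d + 2)) * (T : ℝ) ^ ((d + 1) / (d + 2)) +
        (if d = 0 then Real.log T else 1) *
          (C ^ (1 / (d + 1)) * (T : ℝ) ^ (d / (d + 1))))} with hG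
  have hgood : ∀ᵐ ω ∂P, ω ∈ G ∪ B := by
    filter_upwards [hc, hrun] with ω hcω hrunω
    by_cases hωB : ω ∈ B
    · exact Or.inr hωB
    left
    have hω : ∀ s < T, ∀ n, 1 ≤ n → n ≤ T → ω ∉ RobustZooming.noisyEvent x η T
        (4 * Real.log T + 2 * Real.log (2 / δ)) s n := by
      intro s hs n hn1 hn2 hmem
      refine hωB (Set.mem_biUnion (Finset.mem_range.2 hs) ?_)
      exact Set.mem_biUnion (Finset.mem_Icc.2 ⟨hn1, hn2⟩) hmem
    obtain ⟨S, hS⟩ := hrunω.exists_invariant hT hδ0 hδ1 hC hdiam hlip fun t ht =>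
      RobustZooming.accurate_of_noise (η := fun t => η t ω) (c := fun t => c t ω)
        (fun _ => rfl) hcω ht fun v hv =>
          RobustZooming.abs_pullSum_le_of_notMem_noisyEvent hω ht hv
    exact hS.regret_le hd hα hδ0 hδ1 hT hC hdiam hlip hzoom
  have h1 : 1 ≤ P G + ENNReal.ofReal δ := by
    calc 1 = P Set.univ := measure_univ.symm
      _ ≤ P (G ∪ B) := measure_mono_ae (hgood.mono fun _ h _ => h)
      _ ≤ P G + P B := measure_union_le _ _
      _ ≤ _ := add_le_add_right hbad _
  rw [ENNReal.ofReal_sub _ hδ0.le, ENNReal.ofReal_one]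
  exact tsub_le_iff_right.2 h1
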